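/- Let $N\in\mathbb{N}$ and let $(\beta_\mu)_{\mu\in\mathbb{R}^N}$ be a translation-invariant family of probability densities on $\mathbb{R}^N$, parameterized only by its mean (location) $\mu$: $\beta_\mu(\theta)=\beta_0(\theta-\mu)$ for all $\mu,\theta$. Assume that $\beta_0$ lies in the Schwartz class $\mathcal{S}(\mathbb{R}^N)$, has finite entropy $\mathrm{Ent}(\beta_0)=-\int\beta_0\ln\beta_0$, and that its Fourier transform $\mathcal{F}\beta_0$ vanishes nowhere. Let $r:\mathbb{R}^N\to\mathbb{R}$ be a continuous function that is a tempered distribution and whose Fourier transform $\mathcal{F}r$ has compact support. Put $\check\beta_0(\theta)=\beta_0(-\theta)$, and let $\frac{\mathcal{F}r}{\mathcal{F}\check\beta_0}$ be the compactly supported distribution $\varphi\mapsto\langle\mathcal{F}r,\varphi/\mathcal{F}\check\beta_0\rangle$. Assume that the tempered distribution $\mathcal{F}^{-1}\left[\frac{\mathcal{F}r}{\mathcal{F}\check\beta_0}\right]$ is a function and that there are $a>0$, $b>0$ and $k\in\mathbb{R}$ with $$\mathcal{F}^{-1}\left[\frac{\mathcal{F}r}{\mathcal{F}\check\beta_0}\right](\theta)\;\ge\;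 a\|\theta\|^b+k\qquad\text{for all }\theta\in\mathbb{R}^N,$$ where $\|\cdot\|$ is the Euclidean norm. Then there exists $\kappa>0$ such that $$\alpha(\theta)=\frac1\kappa\exp\left(-\mathrm{Ent}(\beta_0)-\mathcal{F}^{-1}\left[\frac{\mathcal{F}r}{\mathcal{F}\check\beta_0}\right](\theta)\right)$$ is a probability density for which there is a constant $K\in\mathbb{R}$ with $$r(\mu)=\mathrm{KL}(\beta_\mu\|\alpha)+K\quad\text{for all }\mu\in\mathbb{R}^N,\qquad \mathrm{KL}(\beta\|\alpha)=\int_{\mathbb{R}^N}\ln\left(\frac{\beta}{\alpha}\right)\beta .$$ Moreover $\alpha$ belongs to the class $\mathcal{T}(\mathbb{R}^N)$ of probability densities whose logarithm is (almost everywhere defined, locally integrable and) a tempered distribution, and it is, up to equality almost everywhere, the only probability density in $\mathcal{T}(\mathbb{R}^N)$ satisfying such an identity for some constant $K$. -/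

import Mathlib

open MeasureTheory Distribution
open scoped SchwartzMap FourierTransform ContDiff

noncomputable section

/-- `f` is a probability density with respect to Lebesgue measure on `ℝ^N`. -/
def IsProbDensity {N : ℕ} (f : EuclideanSpace ℝ (Fin N) → ℝ) : Prop :=
  (∀ θ, 0 ≤ f θ) ∧ Integrable f ∧ ∫ θ, f θ = 1

/-- The density `f` has finite differential entropy: `f ln f` is integrable. -/
def HasFiniteEntropy {N : ℕ} (f : EuclideanSpace ℝ (Fin N) → ℝ) : Prop :=
  Integrable fun θ => f θ * Real.log (f θ)

/-- The differential entropy `Ent(f) = - ∫ f ln f`. -/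
def entropy {N : ℕ} (f : EuclideanSpace ℝ (Fin N) → ℝ) : ℝ :=
  - ∫ θ, f θ * Real.log (f θ)

open Classical in
/-- The Kullback--Leibler divergence `KL(f ‖ g) = ∫ ln (f / g) f` of two probability densities.
It is `+∞` if `f` does not vanish almost everywhere on the zero set of `g`, or if `ln (f / g) f`
is not integrable (the negative part of this function always is, for probability densities). -/
def klDensity {N : ℕ} (f g : EuclideanSpace ℝ (Fin N) → ℝ) : EReal :=
  if (∀ᵐ θ, g θ = 0 → f θ = 0) ∧ Integrable (fun θ => Real.log (f θ / g θ) * f θ) then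
    ((∫ θ, Real.log (f θ / g θ) * f θ : ℝ) : EReal)
  else ⊤

/-- The tempered distribution `T` is the locally integrable function `f`:
`⟨T, φ⟩ = ∫ f φ` for every smooth compactly supported `φ`. -/
def IsFunction {N : ℕ} (T : 𝓢'(EuclideanSpace ℝ (Fin N), ℂ))
    (f : EuclideanSpace ℝ (Fin N) → ℝ) : Prop :=
  LocallyIntegrable f ∧
    ∀ φ : 𝓢(EuclideanSpace ℝ (Fin N), ℂ), HasCompactSupport φ → T φ = ∫ θ, (f θ : ℂ) * φ θ

/-- The class `𝒯(ℝ^N)` of log-tempered densities: `ln α` is defined almost everywhere and is a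
tempered distribution. -/
def IsLogTempered {N : ℕ} (α : EuclideanSpace ℝ (Fin N) → ℝ) : Prop :=
  (∀ᵐ θ, 0 < α θ) ∧
    ∃ T : 𝓢'(EuclideanSpace ℝ (Fin N), ℂ), IsFunction T (fun θ => Real.log (α θ))

/-- A radius `R ≥ 0` such that a bounded set `s` is contained in the closed ball of radius `R`
around `0`. -/
def outerRadius {N : ℕ} (s : Set (EuclideanSpace ℝ (Fin N))) : ℝ :=
  sSup ((fun ξ => ‖ξ‖) '' s)

theorem outerRadius_nonneg {N : ℕ} (s : Set (EuclideanSpace ℝ (Fin N))) : 0 ≤ outerRadius s :=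
  Real.sSup_nonneg (by rintro _ ⟨ξ, -, rfl⟩; exact norm_nonneg ξ)

/-- A smooth compactly supported function which is equal to `1` on a neighbourhood of the
bounded set `s`. -/
def cutoff {N : ℕ} (s : Set (EuclideanSpace ℝ (Fin N))) :
    ContDiffBump (0 : EuclideanSpace ℝ (Fin N)) where
  rIn := outerRadius s + 1
  rOut := outerRadius s + 2
  rIn_pos := by linarith [outerRadius_nonneg s]
  rIn_lt_rOut := by linarith

/-- The quotient `S / m` of a compactly supported distribution `S` by a nowhere vanishing smooth
function `m`: `⟨S / m, φ⟩ = ⟨S, χ φ / m⟩`, where `χ` is a smooth compactly supported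
function equal to `1` near the support of `S`. -/
def divSmooth {N : ℕ} (S : 𝓢'(EuclideanSpace ℝ (Fin N), ℂ))
    (m : EuclideanSpace ℝ (Fin N) → ℂ) : 𝓢'(EuclideanSpace ℝ (Fin N), ℂ) :=
  TemperedDistribution.smulLeftCLM ℂ (fun ξ => (cutoff (dsupport S) ξ : ℂ) / m ξ) S

/-- The tempered distribution `𝓕⁻¹ [𝓕 r / 𝓕 β̌]`, where `β̌ θ = β (-θ)`, for a tempered
distribution `r` with compactly supported Fourier transform and a density `β`. It is the same for
every normalization of the Fourier transform, because a change of normalization rescales the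
frequency variable in `𝓕 r` and in `𝓕 β̌` alike and is undone by `𝓕⁻¹`. -/
def deconvolution {N : ℕ} (r : 𝓢'(EuclideanSpace ℝ (Fin N), ℂ))
    (β : EuclideanSpace ℝ (Fin N) → ℝ) : 𝓢'(EuclideanSpace ℝ (Fin N), ℂ) :=
  𝓕⁻ (divSmooth (𝓕 r) (𝓕 (fun θ : EuclideanSpace ℝ (Fin N) => (β (-θ) : ℂ))))

/-- `r μ = KL(β_μ ‖ α)` for all `μ`, up to an additive real constant. -/
def IsPenaltyOfPrior {N : ℕ} (r : EuclideanSpace ℝ (Fin N) → ℝ)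
    (β : EuclideanSpace ℝ (Fin N) → EuclideanSpace ℝ (Fin N) → ℝ)
    (α : EuclideanSpace ℝ (Fin N) → ℝ) : Prop :=
  ∃ K : ℝ, ∀ μ, (r μ : EReal) = klDensity (β μ) α + (K : EReal)

end

/-!
Write `b = β 0`, `b̌ θ = b (-θ)` and `b_μ = b (· - μ)`. Since `KL(b_μ ‖ α) = -Ent(b) - ∫ ln α · b_μ`,
the identity `r = KL(b_μ ‖ α) + K` says that the function `h = -ln α` solves the deconvolution problem
`b̌ * h = r + const`.

*Existence.* The function `g` solves `b̌ * g = r` exactly. On the side of distributions, the inverse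
Fourier transform of `b_μ` is `e^{2πi⟨μ, ·⟩} 𝓕 b̌`, whose second factor cancels the division by `𝓕 b̌`;
what remains is `𝓕 r` applied to the character at `μ`, which is `r μ` by Fourier inversion for
distributions with compactly supported Fourier transform (`IsFunction.apply_eq_fourier_apply`,
`deconvolution_apply_translation`). The Paley–Wiener theorem is not needed: `r` is continuous, so that
it suffices to test it against an approximate identity. On the side of functions, the pairing with
`b_μ` is the absolutely convergent integral `∫ g b_μ`. As the Schwartz function `b_μ` is not compactly
supported, this is a statement about `g`; it follows from Fatou's lemma because `g` is bounded below
(`IsFunction.integrable_mul_of_neg_le`). The growth of `g` makes `exp (-g)` integrable.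

*Uniqueness.* If `α'` is another solution, then `-ln α' ≥ -α'` is bounded below by an integrable
function, so that the same argument applies to it. Hence `-ln α'` and `g + C`, for a suitable constant
`C`, have the same integrals against all `b_μ`, and by Fubini the corresponding distributions agree on
all convolutions `b * φ` (`IsFunction.apply_convolution`). As `𝓕 b` vanishes nowhere, these are dense
(`TemperedDistribution.eq_zero_of_apply_convolution_eq_zero`), so `-ln α' = g + C` almost everywhere,
and the normalization fixes `C`.
-/

/-! ### Cutting off Schwartz functions by dilation -/

open Filter Topology in
/-- Dilating the multiplier `w` by a factor `ε ≤ 1` makes it `O(ε (1 + ‖x‖))`-close to `w 0`,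
together with all its derivatives. -/
lemma SchwartzMap.exists_norm_iteratedFDeriv_dilation_sub_le {E : Type*} [NormedAddCommGroup E]
    [NormedSpace ℝ E] (w : 𝓢(E, ℂ)) (n : ℕ) :
    ∃ M : ℝ, 0 ≤ M ∧ ∀ ε : ℝ, 0 ≤ ε → ε ≤ 1 → ∀ i ≤ n, ∀ x : E,
      ‖iteratedFDeriv ℝ i (fun x => w (ε • x) - w 0) x‖ ≤ ε * M * (1 + ‖x‖) := by
  have hpos : ∀ j ∈ Finset.range (n + 2), 0 ≤ SchwartzMap.seminorm ℝ 0 j w :=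
    fun j _ => apply_nonneg _ _
  refine ⟨∑ j ∈ Finset.range (n + 2), SchwartzMap.seminorm ℝ 0 j w, Finset.sum_nonneg hpos, ?_⟩
  set M := ∑ j ∈ Finset.range (n + 2), SchwartzMap.seminorm ℝ 0 j w
  have hM0 : 0 ≤ M := Finset.sum_nonneg hpos
  have hM : ∀ j ≤ n + 1, ∀ x, ‖iteratedFDeriv ℝ j w x‖ ≤ M := fun j hj x =>
    (w.norm_iteratedFDeriv_le_seminorm ℝ j x).trans
      (Finset.single_le_sum hpos (Finset.mem_range.2 (by omega)))
  intro ε hε hε1 i hi x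
  rcases Nat.eq_zero_or_pos i with rfl | hi0
  · rw [norm_iteratedFDeriv_zero]
    have h1 : ‖w (ε • x) - w 0‖ ≤ M * ‖ε • x - 0‖ :=
      convex_univ.norm_image_sub_le_of_norm_fderiv_le (fun y _ => w.differentiableAt)
        (fun y _ => by
          rw [← norm_iteratedFDeriv_one]
          exact hM 1 (by omega) y) (Set.mem_univ _) (Set.mem_univ _)
    rw [sub_zero, norm_smul, Real.norm_of_nonneg hε] at h1
    nlinarith [mul_nonneg hε hM0]
  · have h2 : iteratedFDeriv ℝ i (fun x => w (ε • x) - w 0) x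
        = iteratedFDeriv ℝ i (w ∘ (ε • ContinuousLinearMap.id ℝ E)) x := by
      have hc : ContDiff ℝ i (w ∘ (ε • ContinuousLinearMap.id ℝ E)) :=
        (w.smooth i).comp (ContinuousLinearMap.contDiff _)
      have := iteratedFDeriv_sub_apply (𝕜 := ℝ) (x := x) hc.contDiffAt
        (contDiff_const (c := w 0) (n := (i : WithTop ℕ∞))).contDiffAt
      rw [iteratedFDeriv_const_of_ne hi0.ne' (w 0) (𝕜 := ℝ)] at this
      simpa [Function.comp_def, Pi.sub_def] using this
    rw [h2, ContinuousLinearMap.iteratedFDeriv_comp_right _ (w.smooth i) x le_rfl]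
    refine (ContinuousMultilinearMap.norm_compContinuousLinearMap_le _ _).trans ?_
    have h3 : ‖ε • ContinuousLinearMap.id ℝ E‖ ≤ ε := by
      rw [norm_smul, Real.norm_of_nonneg hε]
      exact mul_le_of_le_one_right hε ContinuousLinearMap.norm_id_le
    have h4 : ∏ _j : Fin i, ‖ε • ContinuousLinearMap.id ℝ E‖ ≤ ε := by
      rw [Finset.prod_const, Finset.card_univ, Fintype.card_fin]
      calc _ ≤ ε ^ i := pow_le_pow_left₀ (norm_nonneg _) h3 i
        _ ≤ ε := pow_le_of_le_one hε hε1 hi0.ne'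
    calc _ ≤ M * ε := mul_le_mul (hM i (by omega) _) h4
          (Finset.prod_nonneg fun _ _ => norm_nonneg _) hM0
      _ ≤ ε * M * (1 + ‖x‖) := by
        nlinarith [mul_nonneg (mul_nonneg hε hM0) (norm_nonneg x)]

lemma SchwartzMap.hasTemperateGrowth_dilation {E : Type*} [NormedAddCommGroup E]
    [NormedSpace ℝ E] (w : 𝓢(E, ℂ)) (ε : ℝ) :
    Function.HasTemperateGrowth (fun x => w (ε • x)) :=
  w.hasTemperateGrowth.comp (ε • ContinuousLinearMap.id ℝ E).hasTemperateGrowth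

open Filter Topology in
/-- If `w 0 = 1`, then multiplication by the dilation `w (ε ·)` converges to the identity in the
Schwartz topology as `ε → 0`. -/
lemma SchwartzMap.tendsto_smulLeftCLM_dilation {E : Type*} [NormedAddCommGroup E]
    [NormedSpace ℝ E] (w ψ : 𝓢(E, ℂ)) (hw : w 0 = 1) {ε : ℕ → ℝ} (hε0 : ∀ n, 0 ≤ ε n)
    (hε1 : ∀ n, ε n ≤ 1) (hε : Tendsto ε atTop (𝓝 0)) :
    Tendsto (fun n => SchwartzMap.smulLeftCLM ℂ (fun x => w (ε n • x)) ψ) atTop (𝓝 ψ) := by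
  rw [(schwartz_withSeminorms ℝ E ℂ).tendsto_nhds _ ψ]
  rintro ⟨k, l⟩ δ hδ
  obtain ⟨M, hM0, hM⟩ := w.exists_norm_iteratedFDeriv_dilation_sub_le l
  set K : ℝ := ∑ i ∈ Finset.range (l + 1), (l.choose i : ℝ) * M *
    (SchwartzMap.seminorm ℝ k (l - i) ψ + SchwartzMap.seminorm ℝ (k + 1) (l - i) ψ) with hK
  have hK0 : 0 ≤ K := Finset.sum_nonneg fun i _ => mul_nonneg (by positivity)
    (add_nonneg (apply_nonneg _ _) (apply_nonneg _ _))
  have hb : ∀ n, schwartzSeminormFamily ℝ E ℂ (k, l)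
      (SchwartzMap.smulLeftCLM ℂ (fun x => w (ε n • x)) ψ - ψ) ≤ ε n * K := by
    intro n
    refine SchwartzMap.seminorm_le_bound ℝ k l _ (mul_nonneg (hε0 n) hK0) fun x => ?_
    have h1 : ⇑(SchwartzMap.smulLeftCLM ℂ (fun x => w (ε n • x)) ψ - ψ)
        = fun x => (w (ε n • x) - w 0) * ψ x := by
      ext x
      simp [SchwartzMap.smulLeftCLM_apply_apply (w.hasTemperateGrowth_dilation _), hw, sub_mul]
    have hs : ContDiff ℝ ∞ (fun x => w (ε n • x) - w 0) :=
      (w.hasTemperateGrowth_dilation (ε n)).1.sub contDiff_const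
    rw [h1]
    calc _ ≤ ‖x‖ ^ k * ∑ i ∈ Finset.range (l + 1), (l.choose i : ℝ) *
          ‖iteratedFDeriv ℝ i (fun x => w (ε n • x) - w 0) x‖ * ‖iteratedFDeriv ℝ (l - i) ψ x‖ := by
          gcongr
          exact norm_iteratedFDeriv_mul_le hs (ψ.smooth ⊤) x (mod_cast le_top)
      _ ≤ ε n * K := by
          rw [hK, Finset.mul_sum, Finset.mul_sum]
          refine Finset.sum_le_sum fun i hi => ?_
          have hi' : i ≤ l := Nat.lt_succ_iff.1 (Finset.mem_range.1 hi)
          calc _ ≤ ‖x‖ ^ k * ((l.choose i : ℝ) * (ε n * M * (1 + ‖x‖)) *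
                ‖iteratedFDeriv ℝ (l - i) ψ x‖) := by
                gcongr
                exact hM _ (hε0 n) (hε1 n) i hi' x
            _ = ε n * ((l.choose i : ℝ) * M * (‖x‖ ^ k * ‖iteratedFDeriv ℝ (l - i) ψ x‖ +
                ‖x‖ ^ (k + 1) * ‖iteratedFDeriv ℝ (l - i) ψ x‖)) := by ring
            _ ≤ _ := by
                have := hε0 n
                gcongr
                · exact SchwartzMap.le_seminorm ℝ k (l - i) ψ x
                · exact SchwartzMap.le_seminorm ℝ (k + 1) (l - i) ψ x
  have hlim : Tendsto (fun n => ε n * K) atTop (𝓝 0) := by simpa using hε.mul_const K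
  filter_upwards [hlim.eventually_lt_const hδ] with n hn
  exact (hb n).trans_lt hn

open Filter Topology in
/-- Compactly supported smooth functions are sequentially dense in the Schwartz space: every `ψ` is
the limit of the products `η n * ψ` for smooth compactly supported cutoffs `0 ≤ η n ≤ 1` which
converge to `1` pointwise. -/
lemma SchwartzMap.exists_cutoff_tendsto (E : Type*) [NormedAddCommGroup E] [InnerProductSpace ℝ E]
    [FiniteDimensional ℝ E] :
    ∃ η : ℕ → E → ℝ, (∀ n, HasCompactSupport (η n)) ∧ (∀ n, ContDiff ℝ ∞ (η n)) ∧
      (∀ n x, 0 ≤ η n x) ∧ (∀ n x, η n x ≤ 1) ∧ (∀ x, Tendsto (η · x) atTop (𝓝 1)) ∧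
      ∀ ψ : 𝓢(E, ℂ), Tendsto (fun n => SchwartzMap.smulLeftCLM ℂ (fun x => (η n x : ℂ)) ψ)
        atTop (𝓝 ψ) := by
  let f : ContDiffBump (0 : E) := ⟨1, 2, one_pos, one_lt_two⟩
  have hf1 : f 0 = 1 := f.one_of_mem_closedBall (by simp [f.rIn_pos.le])
  have hfc : HasCompactSupport (fun x => (f x : ℂ)) :=
    f.hasCompactSupport.comp_left (g := fun t : ℝ => (t : ℂ)) Complex.ofReal_zero
  have hfs : ContDiff ℝ ∞ (fun x => (f x : ℂ)) := Complex.ofRealCLM.contDiff.comp f.contDiff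
  let w : 𝓢(E, ℂ) := hfc.toSchwartzMap hfs
  have hw : ∀ x, w x = f x := fun x => rfl
  have hε : Tendsto (fun n : ℕ => 1 / ((n : ℝ) + 1)) atTop (𝓝 0) :=
    tendsto_one_div_add_atTop_nhds_zero_nat
  have hne : ∀ n : ℕ, 1 / ((n : ℝ) + 1) ≠ 0 := fun n => by positivity
  refine ⟨fun n x => f ((1 / ((n : ℝ) + 1)) • x), fun n => ?_, fun n => ?_,
    fun n x => f.nonneg, fun n x => f.le_one, fun x => ?_, fun ψ => ?_⟩
  · exact f.hasCompactSupport.comp_homeomorph (Homeomorph.smulOfNeZero _ (hne n))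
  · exact f.contDiff.comp (contDiff_const_smul _)
  · have h1 : Tendsto (fun n : ℕ => (1 / ((n : ℝ) + 1)) • x) atTop (𝓝 ((0 : ℝ) • x)) :=
      hε.smul_const x
    rw [zero_smul] at h1
    have := (f.continuous.tendsto 0).comp h1
    rwa [hf1] at this
  · exact w.tendsto_smulLeftCLM_dilation ψ (by simp [hw, hf1]) (fun n => by positivity)
      (fun n => by rw [div_le_one (by positivity)]; linarith [n.cast_nonneg (α := ℝ)]) hε

/-! ### Supports of tempered distributions -/

/-- A tempered distribution vanishes on the compactly supported test functions which live off its
support: a smooth partition of unity splits such a test function into pieces living on open sets on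
which the distribution vanishes. -/
lemma TemperedDistribution.apply_eq_zero_of_tsupport_subset_compl_of_hasCompactSupport
    {E : Type*} [NormedAddCommGroup E] [InnerProductSpace ℝ E] [FiniteDimensional ℝ E]
    (S : 𝓢'(E, ℂ)) (u : 𝓢(E, ℂ)) (hc : HasCompactSupport u) (hu : tsupport u ⊆ (dsupport S)ᶜ) :
    S u = 0 := by
  have hex : ∀ x : E, ∃ U : Set E, IsOpen U ∧ (x ∈ tsupport u → x ∈ U ∧ IsVanishingOn S U) := by
    intro x
    by_cases hx : x ∈ tsupport u
    · obtain ⟨U, hU, ho, hxU⟩ := (notMem_dsupport_iff x).1 (hu hx)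
      exact ⟨U, ho, fun _ => ⟨hxU, hU⟩⟩
    · exact ⟨∅, isOpen_empty, fun h => absurd h hx⟩
  choose U hUo hU using hex
  obtain ⟨t, ht⟩ := hc.elim_finite_subcover (fun x : tsupport u => U x) (fun x => hUo x)
    fun x hx => Set.mem_iUnion.2 ⟨⟨x, hx⟩, (hU x hx).1⟩
  have hcov : tsupport u ⊆ ⋃ i : t, U i := fun x hx => by
    obtain ⟨i, hi⟩ := Set.mem_iUnion.1 (ht hx)
    obtain ⟨hit, hxi⟩ := Set.mem_iUnion.1 hi
    exact Set.mem_iUnion.2 ⟨⟨i, hit⟩, hxi⟩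
  obtain ⟨f, hf⟩ := SmoothPartitionOfUnity.exists_isSubordinate (modelWithCornersSelf ℝ E)
    (isClosed_tsupport u) (fun i : t => U i) (fun i => hUo i) hcov
  have hsm : ∀ i, ContDiff ℝ ∞ (fun x => (f i x : ℂ) * u x) := fun i =>
    (Complex.ofRealCLM.contDiff.comp (f i).contMDiff.contDiff).mul (u.smooth ⊤)
  have hcs : ∀ i, HasCompactSupport (fun x => (f i x : ℂ) * u x) := fun i => hc.mul_left
  have hsum : u = ∑ i, (hcs i).toSchwartzMap (hsm i) := by
    ext x
    simp only [FunLike.coe_sum, Finset.sum_apply,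
      HasCompactSupport.toSchwartzMap_toFun]
    by_cases hx : x ∈ tsupport u
    · have h1 := f.sum_eq_one hx
      rw [finsum_eq_sum_of_fintype] at h1
      rw [← Finset.sum_mul, ← Complex.ofReal_sum, h1, Complex.ofReal_one, one_mul]
    · simp [image_eq_zero_of_notMem_tsupport hx]
  rw [hsum, map_sum]
  refine Finset.sum_eq_zero fun i _ => ?_
  refine (hU i i.1.2).2 _ (Set.Subset.trans (closure_mono fun x hx => ?_) (hf i))
  contrapose! hx
  simp [Function.notMem_support.1 hx]

/-- A tempered distribution vanishes on the test functions which live off its support. -/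
lemma TemperedDistribution.isVanishingOn_compl_dsupport
    {E : Type*} [NormedAddCommGroup E] [InnerProductSpace ℝ E] [FiniteDimensional ℝ E]
    (S : 𝓢'(E, ℂ)) : IsVanishingOn S (dsupport S)ᶜ := by
  intro u hu
  obtain ⟨η, hηc, hηs, -, -, -, hη⟩ := SchwartzMap.exists_cutoff_tendsto E
  have hg : ∀ n, Function.HasTemperateGrowth (fun x => (η n x : ℂ)) := fun n =>
    ((hηc n).comp_left (g := fun t : ℝ => (t : ℂ)) Complex.ofReal_zero).hasTemperateGrowth
      (Complex.ofRealCLM.contDiff.comp (hηs n))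
  have h0 : ∀ n, S (SchwartzMap.smulLeftCLM ℂ (fun x => (η n x : ℂ)) u) = 0 := by
    intro n
    refine S.apply_eq_zero_of_tsupport_subset_compl_of_hasCompactSupport _ ?_ ?_
    · rw [SchwartzMap.smulLeftCLM_apply (hg n)]
      exact ((hηc n).comp_left (g := fun t : ℝ => (t : ℂ)) Complex.ofReal_zero).smul_right
    · exact ((SchwartzMap.tsupport_smulLeftCLM_subset _ _).trans Set.inter_subset_left).trans hu
  have hlim := (S.continuous.tendsto u).comp (hη u)
  exact tendsto_nhds_unique (hlim.congr h0) tendsto_const_nhds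

/-- Multiplying test functions by a function which equals `1` on a neighbourhood of the support of
a tempered distribution does not affect the distribution. -/
lemma TemperedDistribution.apply_smulLeftCLM_of_eq_one
    {E : Type*} [NormedAddCommGroup E] [InnerProductSpace ℝ E] [FiniteDimensional ℝ E]
    (S : 𝓢'(E, ℂ)) {χ : E → ℂ} (hχ : χ.HasTemperateGrowth) {U : Set E} (hU : IsOpen U)
    (hS : dsupport S ⊆ U) (h1 : ∀ x ∈ U, χ x = 1) (u : 𝓢(E, ℂ)) :
    S (SchwartzMap.smulLeftCLM ℂ χ u) = S u := by
  rw [← sub_eq_zero, ← map_sub]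
  refine S.isVanishingOn_compl_dsupport _ ?_
  refine Set.Subset.trans ?_ (Set.compl_subset_compl.2 hS)
  refine closure_minimal (fun x hx hxU => hx ?_) hU.isClosed_compl
  simp [SchwartzMap.smulLeftCLM_apply_apply hχ, h1 x hxU]

/-! ### Tempered distributions which are functions -/

/-- A real Schwartz function, regarded as a complex one. -/
noncomputable def SchwartzMap.complexify {E : Type*} [NormedAddCommGroup E] [NormedSpace ℝ E]
    (b : 𝓢(E, ℝ)) : 𝓢(E, ℂ) :=
  SchwartzMap.postcompCLM (𝕜 := ℝ) Complex.ofRealCLM b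

@[simp]
lemma SchwartzMap.complexify_apply {E : Type*} [NormedAddCommGroup E] [NormedSpace ℝ E]
    (b : 𝓢(E, ℝ)) (x : E) : b.complexify x = b x := rfl

open Filter Topology in
/-- The identity `⟨T, φ⟩ = ∫ f φ` extends from compactly supported test functions to every Schwartz
function `ψ` for which the integral converges absolutely. -/
lemma IsFunction.apply_eq_integral {N : ℕ} {T : 𝓢'(EuclideanSpace ℝ (Fin N), ℂ)}
    {f : EuclideanSpace ℝ (Fin N) → ℝ} (hf : IsFunction T f) (ψ : 𝓢(EuclideanSpace ℝ (Fin N), ℂ))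
    (hint : Integrable fun θ => (f θ : ℂ) * ψ θ) : T ψ = ∫ θ, (f θ : ℂ) * ψ θ := by
  obtain ⟨η, hηc, hηs, hη0, hη1, hηl, hη⟩ :=
    SchwartzMap.exists_cutoff_tendsto (EuclideanSpace ℝ (Fin N))
  have hc : ∀ n, HasCompactSupport (fun x => (η n x : ℂ)) := fun n =>
    (hηc n).comp_left (g := fun t : ℝ => (t : ℂ)) Complex.ofReal_zero
  have hs : ∀ n, ContDiff ℝ ∞ (fun x => (η n x : ℂ)) := fun n =>
    Complex.ofRealCLM.contDiff.comp (hηs n)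
  have hg : ∀ n, Function.HasTemperateGrowth (fun x => (η n x : ℂ)) := fun n =>
    (hc n).hasTemperateGrowth (hs n)
  have happ : ∀ n, T (SchwartzMap.smulLeftCLM ℂ (fun x => (η n x : ℂ)) ψ)
      = ∫ θ, (η n θ : ℂ) * ((f θ : ℂ) * ψ θ) := by
    intro n
    rw [hf.2 _ (by rw [SchwartzMap.smulLeftCLM_apply (hg n)]; exact (hc n).smul_right)]
    refine integral_congr_ae (Eventually.of_forall fun θ => ?_)
    simp only [SchwartzMap.smulLeftCLM_apply_apply (hg n), smul_eq_mul]
    ring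
  have hlim := (T.continuous.tendsto ψ).comp (hη ψ)
  refine tendsto_nhds_unique (hlim.congr happ) ?_
  refine tendsto_integral_of_dominated_convergence (fun θ => ‖(f θ : ℂ) * ψ θ‖)
    (fun n => (hs n).continuous.aestronglyMeasurable.mul hint.aestronglyMeasurable) hint.norm
    (fun n => Eventually.of_forall fun θ => ?_) (Eventually.of_forall fun θ => ?_)
  · rw [norm_mul, Complex.norm_real, Real.norm_of_nonneg (hη0 n θ)]
    exact mul_le_of_le_one_left (norm_nonneg _) (hη1 n θ)
  · have h1 := ((Complex.continuous_ofReal.tendsto 1).comp (hηl θ)).mul_const ((f θ : ℂ) * ψ θ)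
    simpa using h1

open Filter Topology in
/-- A tempered distribution which is a function `f ≥ -q` is of moderate growth on average: `f` is
absolutely integrable against every nonnegative Schwartz function against which `q` is. Without the lower bound this fails,
as a rapidly oscillating function of exponential growth may be a tempered distribution. -/
lemma IsFunction.integrable_mul_of_neg_le {N : ℕ} {T : 𝓢'(EuclideanSpace ℝ (Fin N), ℂ)}
    {f q : EuclideanSpace ℝ (Fin N) → ℝ} (hf : IsFunction T f) (hq : ∀ᵐ θ, -q θ ≤ f θ)
    (ψ : 𝓢(EuclideanSpace ℝ (Fin N), ℝ)) (hψ : ∀ θ, 0 ≤ ψ θ)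
    (hqψ : Integrable fun θ => q θ * ψ θ) : Integrable fun θ => f θ * ψ θ := by
  obtain ⟨η, hηc, hηs, hη0, hη1, hηl, hη⟩ :=
    SchwartzMap.exists_cutoff_tendsto (EuclideanSpace ℝ (Fin N))
  have hc : ∀ n, HasCompactSupport (fun x => (η n x : ℂ)) := fun n =>
    (hηc n).comp_left (g := fun t : ℝ => (t : ℂ)) Complex.ofReal_zero
  have hs : ∀ n, ContDiff ℝ ∞ (fun x => (η n x : ℂ)) := fun n =>
    Complex.ofRealCLM.contDiff.comp (hηs n)
  have hg : ∀ n, Function.HasTemperateGrowth (fun x => (η n x : ℂ)) := fun n =>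
    (hc n).hasTemperateGrowth (hs n)
  have hfη : ∀ n, Integrable fun θ => f θ * (η n θ * ψ θ) := fun n =>
    hf.1.integrable_smul_right_of_hasCompactSupport ((hηs n).continuous.mul ψ.continuous)
      (hηc n).mul_right
  have hqη : ∀ n, Integrable fun θ => q θ * (η n θ * ψ θ) := by
    intro n
    refine (hqψ.bdd_mul (c := 1) (hηs n).continuous.aestronglyMeasurable
      (Eventually.of_forall fun θ => ?_)).congr (Eventually.of_forall fun θ => ?_)
    · rw [Real.norm_of_nonneg (hη0 n θ)]
      exact hη1 n θ
    · ring
  have happ : ∀ n, T (SchwartzMap.smulLeftCLM ℂ (fun x => (η n x : ℂ)) ψ.complexify)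
      = ((∫ θ, f θ * (η n θ * ψ θ) : ℝ) : ℂ) := by
    intro n
    rw [hf.2 _ (by rw [SchwartzMap.smulLeftCLM_apply (hg n)]; exact (hc n).smul_right),
      ← integral_complex_ofReal]
    refine integral_congr_ae (Eventually.of_forall fun θ => ?_)
    simp [SchwartzMap.smulLeftCLM_apply_apply (hg n)]
  obtain ⟨C, hC⟩ : ∃ C, ∀ n, ∫ θ, f θ * (η n θ * ψ θ) ≤ C := by
    have hlim := (T.continuous.tendsto ψ.complexify).comp (hη ψ.complexify)
    have hlim' := (Complex.continuous_re.tendsto _).comp (hlim.congr happ)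
    obtain ⟨C, hC⟩ := hlim'.bddAbove_range
    exact ⟨C, fun n => by simpa using hC (Set.mem_range_self n)⟩
  have hsum : Integrable fun θ => f θ * ψ θ + q θ * ψ θ := by
    have hmeas : AEStronglyMeasurable (fun θ => f θ * ψ θ + q θ * ψ θ) :=
      (hf.1.aestronglyMeasurable.mul ψ.continuous.aestronglyMeasurable).add
        hqψ.aestronglyMeasurable
    refine ⟨hmeas, ?_⟩
    set F : ℕ → EuclideanSpace ℝ (Fin N) → ℝ :=
      fun n θ => f θ * (η n θ * ψ θ) + q θ * (η n θ * ψ θ)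
    have hFi : ∀ n, Integrable (F n) := fun n => (hfη n).add (hqη n)
    have hF0 : ∀ n, 0 ≤ᵐ[volume] F n := by
      intro n
      filter_upwards [hq] with θ hθ
      have : F n θ = (f θ + q θ) * (η n θ * ψ θ) := by simp only [F]; ring
      rw [this]
      exact mul_nonneg (by linarith) (mul_nonneg (hη0 n θ) (hψ θ))
    have hFb : ∀ n, ∫⁻ θ, ‖F n θ‖ₑ ≤ ENNReal.ofReal (C + ∫ θ, |q θ * ψ θ|) := by
      intro n
      rw [← ofReal_integral_norm_eq_lintegral_enorm (hFi n)]
      refine ENNReal.ofReal_le_ofReal ?_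
      have h1 : ∫ θ, ‖F n θ‖ = ∫ θ, F n θ := integral_congr_ae (by
        filter_upwards [hF0 n] with θ hθ
        exact Real.norm_of_nonneg hθ)
      rw [h1, integral_add (hfη n) (hqη n)]
      refine add_le_add (hC n) (integral_mono (hqη n) hqψ.abs fun θ => ?_)
      calc q θ * (η n θ * ψ θ) = η n θ * (q θ * ψ θ) := by ring
        _ ≤ η n θ * |q θ * ψ θ| := mul_le_mul_of_nonneg_left (le_abs_self _) (hη0 n θ)
        _ ≤ |q θ * ψ θ| := mul_le_of_le_one_left (abs_nonneg _) (hη1 n θ)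
    have hlimF : ∀ θ, Tendsto (fun n => F n θ) atTop (𝓝 (f θ * ψ θ + q θ * ψ θ)) := fun θ => by
      have h1 := (hηl θ).mul_const (f θ * ψ θ + q θ * ψ θ)
      rw [one_mul] at h1
      exact h1.congr fun n => by simp only [F]; ring
    calc ∫⁻ θ, ‖f θ * ψ θ + q θ * ψ θ‖ₑ = ∫⁻ θ, liminf (fun n => ‖F n θ‖ₑ) atTop :=
          lintegral_congr fun θ => (hlimF θ).enorm.liminf_eq.symm
      _ ≤ liminf (fun n => ∫⁻ θ, ‖F n θ‖ₑ) atTop :=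
          lintegral_liminf_le' fun n => (hFi n).aestronglyMeasurable.aemeasurable.enorm
      _ ≤ ENNReal.ofReal (C + ∫ θ, |q θ * ψ θ|) :=
          liminf_le_of_frequently_le' (Frequently.of_forall hFb)
      _ < ⊤ := ENNReal.ofReal_lt_top
  exact (hsum.sub hqψ).congr (Eventually.of_forall fun θ => by simp)

/-! ### Translation identity for the deconvolution -/

/-- The inverse Fourier transform of an `L¹`-normalized dilation, translated by `μ`. -/
lemma Real.fourierInv_dilation_translation {E : Type*} [NormedAddCommGroup E]
    [InnerProductSpace ℝ E] [FiniteDimensional ℝ E] [MeasurableSpace E] [BorelSpace E]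
    (f : E → ℂ) {ε : ℝ} (hε : 0 < ε) (μ ξ : E) :
    𝓕⁻ (fun x => ((ε ^ Module.finrank ℝ E)⁻¹ : ℝ) • f (ε⁻¹ • (x - μ))) ξ
      = (Real.fourierChar (inner ℝ μ ξ) : ℂ) * 𝓕⁻ f (ε • ξ) := by
  rw [Real.fourierInv_eq, Real.fourierInv_eq]
  set G : E → ℂ := fun w => (Real.fourierChar (inner ℝ (μ + ε • w) ξ) : ℂ) * f w with hG
  have h1 : ∀ x : E, Real.fourierChar (inner ℝ x ξ) •
      (((ε ^ Module.finrank ℝ E)⁻¹ : ℝ) • f (ε⁻¹ • (x - μ)))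
      = ((ε ^ Module.finrank ℝ E)⁻¹ : ℝ) • G (ε⁻¹ • (x - μ)) := by
    intro x
    rw [smul_comm]
    simp [hG, smul_smul, mul_inv_cancel₀ hε.ne', Circle.smul_def]
  simp_rw [h1]
  rw [integral_smul, integral_sub_right_eq_self (fun x => G (ε⁻¹ • x)) μ,
    Measure.integral_comp_inv_smul_of_nonneg _ _ hε.le, smul_smul,
    inv_mul_cancel₀ (pow_pos hε _).ne', one_smul, ← integral_const_mul]
  refine integral_congr_ae (Filter.Eventually.of_forall fun w => ?_)
  simp [hG, inner_add_left, inner_smul_left, inner_smul_right, AddChar.map_add_eq_mul,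
    Circle.smul_def, mul_assoc]

lemma SchwartzMap.fourierInv_compSubConstCLM_apply {E : Type*} [NormedAddCommGroup E]
    [InnerProductSpace ℝ E] [FiniteDimensional ℝ E] [MeasurableSpace E] [BorelSpace E]
    (ψ : 𝓢(E, ℂ)) (μ ξ : E) :
    𝓕⁻ (SchwartzMap.compSubConstCLM ℂ μ ψ) ξ
      = (Real.fourierChar (inner ℝ μ ξ) : ℂ) * 𝓕⁻ ψ ξ := by
  have := Real.fourierInv_dilation_translation ψ one_pos μ ξ
  have h : ⇑(SchwartzMap.compSubConstCLM ℂ μ ψ) = fun x => ψ (x - μ) :=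
    funext fun x => SchwartzMap.compSubConstCLM_apply ψ μ x
  rw [SchwartzMap.fourierInv_coe, SchwartzMap.fourierInv_coe, h]
  simpa using this

lemma SchwartzMap.exists_hasCompactSupport_dilation_translation {E F : Type*}
    [NormedAddCommGroup E] [NormedSpace ℝ E] [NormedAddCommGroup F] [NormedSpace ℝ F]
    (P : 𝓢(E, F)) (hP : HasCompactSupport P) {ε : ℝ} (hε : ε ≠ 0) (c : ℝ) (μ : E) :
    ∃ φ : 𝓢(E, F), HasCompactSupport φ ∧ ⇑φ = fun x => c • P (ε⁻¹ • (x - μ)) := by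
  have h1 : HasCompactSupport (fun x => P (ε⁻¹ • x)) :=
    hP.comp_homeomorph (Homeomorph.smulOfNeZero _ (inv_ne_zero hε))
  have h2 : HasCompactSupport (fun x => P (ε⁻¹ • (x - μ))) :=
    h1.comp_homeomorph (Homeomorph.subRight μ)
  have h3 : HasCompactSupport (fun x => c • P (ε⁻¹ • (x - μ))) :=
    h2.comp_left (g := fun y => c • y) (smul_zero c)
  have h4 : ContDiff ℝ ∞ (fun x : E => ε⁻¹ • (x - μ)) :=
    (contDiff_id.sub contDiff_const).const_smul ε⁻¹
  have h5 : ContDiff ℝ ∞ (fun x => P (ε⁻¹ • (x - μ))) := (P.smooth ⊤).comp h4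
  exact ⟨h3.toSchwartzMap (contDiff_const.smul h5), h3, rfl⟩

open Filter Topology in
/-- Fourier inversion at a point for a continuous function `r` whose Fourier transform has compact
support: `r μ = ⟨𝓕 r, χ e^{2 π i ⟨μ, ·⟩}⟩`, where `χ` equals `1` near the support of `𝓕 r`.
This is the limit `ε → 0` of the same identity for the mean of `r` against an approximate
identity of width `ε` at `μ`. -/
lemma IsFunction.apply_eq_fourier_apply {N : ℕ} {R : 𝓢'(EuclideanSpace ℝ (Fin N), ℂ)}
    {r : EuclideanSpace ℝ (Fin N) → ℝ} (hR : IsFunction R r) (hr : Continuous r)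
    {χ : EuclideanSpace ℝ (Fin N) → ℂ} (hχ : χ.HasTemperateGrowth)
    {U : Set (EuclideanSpace ℝ (Fin N))} (hU : IsOpen U)
    (hS : dsupport (𝓕 R : 𝓢'(EuclideanSpace ℝ (Fin N), ℂ)) ⊆ U) (h1 : ∀ ξ ∈ U, χ ξ = 1)
    (μ : EuclideanSpace ℝ (Fin N)) (X : 𝓢(EuclideanSpace ℝ (Fin N), ℂ))
    (hX : ∀ ξ, X ξ = χ ξ * (Real.fourierChar (inner ℝ μ ξ) : ℂ)) :
    (r μ : ℂ) = (𝓕 R : 𝓢'(EuclideanSpace ℝ (Fin N), ℂ)) X := by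
  let f : ContDiffBump (0 : EuclideanSpace ℝ (Fin N)) := ⟨1, 2, one_pos, one_lt_two⟩
  set ρ : EuclideanSpace ℝ (Fin N) → ℝ := f.normed volume with hρ
  have hρc : HasCompactSupport ρ := f.hasCompactSupport_normed
  have hρs : ContDiff ℝ ∞ ρ := f.contDiff_normed
  have hρC : HasCompactSupport (fun x => (ρ x : ℂ)) :=
    hρc.comp_left (g := fun t : ℝ => (t : ℂ)) Complex.ofReal_zero
  have hρS : ContDiff ℝ ∞ (fun x => (ρ x : ℂ)) := Complex.ofRealCLM.contDiff.comp hρs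
  obtain ⟨P, hPc, hP⟩ : ∃ P : 𝓢(EuclideanSpace ℝ (Fin N), ℂ), HasCompactSupport P ∧
      ⇑P = fun x => (ρ x : ℂ) := ⟨hρC.toSchwartzMap hρS, hρC, rfl⟩
  have hw0 : (𝓕⁻ P) 0 = 1 := by
    rw [SchwartzMap.fourierInv_coe, Real.fourierInv_eq, hP]
    simp only [inner_zero_right, AddChar.map_zero_eq_one, one_smul]
    rw [integral_complex_ofReal, hρ, f.integral_normed, Complex.ofReal_one]
  set ε : ℕ → ℝ := fun n => 1 / ((n : ℝ) + 1) with hεdef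
  have hε : Tendsto ε atTop (𝓝 0) := tendsto_one_div_add_atTop_nhds_zero_nat
  have hεpos : ∀ n, 0 < ε n := fun n => by positivity
  have hε1 : ∀ n, ε n ≤ 1 := fun n => by
    rw [hεdef, div_le_one (by positivity)]
    linarith [n.cast_nonneg (α := ℝ)]
  set d := Module.finrank ℝ (EuclideanSpace ℝ (Fin N)) with hd
  choose φ hφc hφ using fun n => P.exists_hasCompactSupport_dilation_translation hPc (hεpos n).ne'
    (((ε n) ^ d)⁻¹ : ℝ) μ
  have hleft : ∀ n, R (φ n) = ∫ y, ((r (μ + ε n • y) * ρ y : ℝ) : ℂ) := by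
    intro n
    rw [hR.2 _ (hφc n)]
    set G : EuclideanSpace ℝ (Fin N) → ℂ := fun y => ((r (μ + ε n • y) * ρ y : ℝ) : ℂ) with hG
    have h1 : ∀ x, (r x : ℂ) * φ n x = (((ε n) ^ d)⁻¹ : ℝ) • G ((ε n)⁻¹ • (x - μ)) := by
      intro x
      simp only [hφ, hP, hG, smul_smul, mul_inv_cancel₀ (hεpos n).ne', one_smul,
        add_sub_cancel, Complex.ofReal_mul, Complex.real_smul]
      ring
    simp_rw [h1]
    rw [integral_smul, integral_sub_right_eq_self (fun x => G ((ε n)⁻¹ • x)) μ,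
      Measure.integral_comp_inv_smul_of_nonneg _ _ (hεpos n).le, smul_smul,
      inv_mul_cancel₀ (pow_pos (hεpos n) _).ne', one_smul]
  have hright : ∀ n, R (φ n) = (𝓕 R : 𝓢'(EuclideanSpace ℝ (Fin N), ℂ))
      (SchwartzMap.smulLeftCLM ℂ (fun x => (𝓕⁻ P) (ε n • x)) X) := by
    intro n
    have h2 : R (φ n) = (𝓕 R : 𝓢'(EuclideanSpace ℝ (Fin N), ℂ)) (𝓕⁻ (φ n)) := by
      rw [TemperedDistribution.fourier_apply, FourierTransform.fourier_fourierInv_eq]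
    rw [h2, ← TemperedDistribution.apply_smulLeftCLM_of_eq_one _ hχ hU hS h1]
    congr 1
    ext ξ
    rw [SchwartzMap.smulLeftCLM_apply_apply hχ, SchwartzMap.smulLeftCLM_apply_apply
      ((𝓕⁻ P).hasTemperateGrowth_dilation _), hX, SchwartzMap.fourierInv_coe (φ n),
      SchwartzMap.fourierInv_coe P]
    have h3 := Real.fourierInv_dilation_translation P (hεpos n) μ ξ
    rw [hφ n, h3, smul_eq_mul, smul_eq_mul]
    ring
  have hlim1 : Tendsto (fun n => R (φ n)) atTop (𝓝 ((𝓕 R : 𝓢'(_, ℂ)) X)) := by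
    have := ((𝓕 R : 𝓢'(EuclideanSpace ℝ (Fin N), ℂ)).continuous.tendsto X).comp
      ((𝓕⁻ P).tendsto_smulLeftCLM_dilation X hw0 (fun n => (hεpos n).le) hε1 hε)
    exact this.congr fun n => (hright n).symm
  refine tendsto_nhds_unique ?_ hlim1
  obtain ⟨C, hC⟩ := (isCompact_closedBall μ 2).exists_bound_of_continuousOn hr.continuousOn
  have hlim2 : Tendsto (fun n => ∫ y, r (μ + ε n • y) * ρ y) atTop (𝓝 (∫ y, r μ * ρ y)) := by
    refine tendsto_integral_of_dominated_convergence (fun y => C * ρ y) (fun n => ?_)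
      (f.integrable_normed.const_mul C) (fun n => Eventually.of_forall fun y => ?_)
      (Eventually.of_forall fun y => ?_)
    · exact Continuous.aestronglyMeasurable (by fun_prop)
    · have hρ0 : 0 ≤ ρ y := f.nonneg_normed y
      by_cases hy : ρ y = 0
      · simp [hy]
      · have hy2 : ‖y‖ < 2 := by
          have : y ∈ Function.support (f.normed volume) := hy
          rw [f.support_normed_eq] at this
          simpa using this
        rw [norm_mul, Real.norm_of_nonneg hρ0]
        refine mul_le_mul_of_nonneg_right (hC _ ?_) hρ0
        rw [mem_closedBall_iff_norm, add_sub_cancel_left, norm_smul,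
          Real.norm_of_nonneg (hεpos n).le]
        nlinarith [hε1 n, hεpos n, norm_nonneg y]
    · have h5 : Tendsto (fun n => μ + ε n • y) atTop (𝓝 (μ + (0 : ℝ) • y)) :=
        (hε.smul_const y).const_add μ
      rw [zero_smul, add_zero] at h5
      exact ((hr.tendsto μ).comp h5).mul_const _
  rw [integral_const_mul, hρ, f.integral_normed, mul_one] at hlim2
  have h6 := (Complex.continuous_ofReal.tendsto _).comp hlim2
  refine h6.congr fun n => ?_
  rw [hleft n, integral_complex_ofReal]
  rfl

/-- The translates `b (· - μ)` recover `r` from its deconvolution: `⟨𝓕⁻¹ [𝓕 r / 𝓕 b̌], b (· - μ)⟩`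
is `r μ`, because the factor `𝓕 b̌` cancels against the inverse Fourier transform of the
translate. -/
lemma deconvolution_apply_translation {N : ℕ} {R : 𝓢'(EuclideanSpace ℝ (Fin N), ℂ)}
    {r : EuclideanSpace ℝ (Fin N) → ℝ} (hR : IsFunction R r) (hr : Continuous r)
    (hRc : IsCompact (dsupport (𝓕 R : 𝓢'(EuclideanSpace ℝ (Fin N), ℂ))))
    (b : 𝓢(EuclideanSpace ℝ (Fin N), ℝ)) (hb : ∀ ξ, 𝓕 b.complexify ξ ≠ 0)
    (μ : EuclideanSpace ℝ (Fin N)) :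
    deconvolution R b (SchwartzMap.compSubConstCLM ℝ μ b).complexify = r μ := by
  set S : 𝓢'(EuclideanSpace ℝ (Fin N), ℂ) := 𝓕 R with hS
  set χ : EuclideanSpace ℝ (Fin N) → ℂ := fun ξ => (cutoff (dsupport S) ξ : ℂ) with hχ
  have hχc : HasCompactSupport χ :=
    (cutoff (dsupport S)).hasCompactSupport.comp_left (g := fun t : ℝ => (t : ℂ))
      Complex.ofReal_zero
  have hχs : ContDiff ℝ ∞ χ := Complex.ofRealCLM.contDiff.comp (cutoff (dsupport S)).contDiff
  set m : 𝓢(EuclideanSpace ℝ (Fin N), ℂ) := 𝓕⁻ b.complexify with hmdef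
  have hm : 𝓕 (fun θ : EuclideanSpace ℝ (Fin N) => (b (-θ) : ℂ)) = ⇑m := by
    rw [hmdef, SchwartzMap.fourierInv_coe, Real.fourierInv_eq_fourier_comp_neg]
    rfl
  have hm0 : ∀ ξ, m ξ ≠ 0 := fun ξ => by
    have := hb (-ξ)
    rwa [SchwartzMap.fourier_coe, ← Real.fourierInv_eq_fourier_neg,
      ← SchwartzMap.fourierInv_coe] at this
  have hqc : HasCompactSupport (fun ξ => χ ξ / m ξ) := by
    simp_rw [div_eq_mul_inv]
    exact hχc.mul_right
  have hqs : ContDiff ℝ ∞ (fun ξ => χ ξ / m ξ) := by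
    simp_rw [div_eq_mul_inv]
    exact hχs.mul ((m.smooth ⊤).inv hm0)
  have hq := hqc.hasTemperateGrowth hqs
  have hbμ : (SchwartzMap.compSubConstCLM ℝ μ b).complexify
      = SchwartzMap.compSubConstCLM ℂ μ b.complexify := by
    ext θ
    simp [SchwartzMap.compSubConstCLM_apply]
  rw [deconvolution, TemperedDistribution.fourierInv_apply, divSmooth,
    TemperedDistribution.smulLeftCLM_apply_apply, hm]
  refine (hR.apply_eq_fourier_apply hr (hχc.hasTemperateGrowth hχs)
    (Metric.isOpen_ball (x := 0) (ε := outerRadius (dsupport S) + 1)) (fun ξ hξ => ?_)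
    (fun ξ hξ => ?_) μ _ fun ξ => ?_).symm
  · have h1 : ‖ξ‖ ≤ outerRadius (dsupport S) :=
      le_csSup (hRc.image continuous_norm).bddAbove (Set.mem_image_of_mem _ hξ)
    rw [mem_ball_zero_iff]
    linarith
  · rw [hχ]
    simp only [Complex.ofReal_eq_one]
    exact (cutoff (dsupport S)).one_of_mem_closedBall (Metric.ball_subset_closedBall hξ)
  · rw [SchwartzMap.smulLeftCLM_apply_apply hq, hbμ,
      SchwartzMap.fourierInv_compSubConstCLM_apply, smul_eq_mul]
    rw [← hmdef]
    field_simp [hm0 ξ]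

/-! ### Convolution of a semibounded function with a Schwartz density -/

/-- The translates of a Schwartz function grow at most polynomially in each Schwartz seminorm. -/
lemma SchwartzMap.exists_seminorm_compSubConstCLM_le {E : Type*} [NormedAddCommGroup E]
    [NormedSpace ℝ E] (ψ : 𝓢(E, ℂ)) (k l : ℕ) :
    ∃ C : ℝ, 0 ≤ C ∧ ∀ μ : E, SchwartzMap.seminorm ℂ k l (SchwartzMap.compSubConstCLM ℂ μ ψ) ≤
      C * (1 + ‖μ‖) ^ k := by
  refine ⟨2 ^ k * (Finset.Iic (k, l)).sup (fun m => SchwartzMap.seminorm ℂ m.1 m.2) ψ,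
    mul_nonneg (by positivity) (apply_nonneg _ _), fun μ => ?_⟩
  refine SchwartzMap.seminorm_le_bound ℂ k l _ (mul_nonneg (mul_nonneg (by positivity)
    (apply_nonneg _ _)) (by positivity)) fun x => ?_
  have h : ⇑(SchwartzMap.compSubConstCLM ℂ μ ψ) = fun x => ψ (x - μ) :=
    funext fun x => SchwartzMap.compSubConstCLM_apply ψ μ x
  rw [h, iteratedFDeriv_comp_sub]
  have h1 := SchwartzMap.one_add_le_sup_seminorm_apply (𝕜 := ℂ) (m := (k, l)) le_rfl le_rfl ψ
    (x - μ)
  have h2 : ‖x‖ ≤ (1 + ‖x - μ‖) * (1 + ‖μ‖) := by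
    have := norm_add_le (x - μ) μ
    rw [sub_add_cancel] at this
    nlinarith [norm_nonneg (x - μ), norm_nonneg μ]
  calc ‖x‖ ^ k * ‖iteratedFDeriv ℝ l ψ (x - μ)‖
      ≤ ((1 + ‖x - μ‖) * (1 + ‖μ‖)) ^ k * ‖iteratedFDeriv ℝ l ψ (x - μ)‖ := by gcongr
    _ = ((1 + ‖x - μ‖) ^ k * ‖iteratedFDeriv ℝ l ψ (x - μ)‖) * (1 + ‖μ‖) ^ k := by
        rw [mul_pow]; ring
    _ ≤ _ := by gcongr

/-- The pairings of a tempered distribution with the translates of a Schwartz function grow at most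
polynomially. -/
lemma TemperedDistribution.exists_norm_apply_compSubConstCLM_le {E : Type*} [NormedAddCommGroup E]
    [NormedSpace ℝ E] (T : 𝓢'(E, ℂ)) (ψ : 𝓢(E, ℂ)) :
    ∃ (C : ℝ) (k : ℕ), ∀ μ : E, ‖T (SchwartzMap.compSubConstCLM ℂ μ ψ)‖ ≤ C * (1 + ‖μ‖) ^ k := by
  obtain ⟨s, c, -, hc⟩ := Seminorm.bound_of_continuous (schwartz_withSeminorms ℂ E ℂ)
    ((normSeminorm ℂ ℂ).comp (T : 𝓢(E, ℂ) →ₗ[ℂ] ℂ)) (continuous_norm.comp T.continuous)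
  choose C hC0 hC using fun m : ℕ × ℕ => ψ.exists_seminorm_compSubConstCLM_le m.1 m.2
  refine ⟨c * ∑ m ∈ s, C m, s.sup Prod.fst, fun μ => ?_⟩
  calc ‖T (SchwartzMap.compSubConstCLM ℂ μ ψ)‖
      ≤ c * (s.sup (schwartzSeminormFamily ℂ E ℂ)) (SchwartzMap.compSubConstCLM ℂ μ ψ) :=
        hc (SchwartzMap.compSubConstCLM ℂ μ ψ)
    _ ≤ c * ((∑ m ∈ s, C m) * (1 + ‖μ‖) ^ s.sup Prod.fst) := by
        gcongr
        refine Seminorm.finset_sup_apply_le (mul_nonneg (Finset.sum_nonneg fun m _ => hC0 m)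
          (by positivity)) fun m hm => (hC m μ).trans ?_
        gcongr
        · exact Finset.sum_nonneg fun m _ => hC0 m
        · exact Finset.single_le_sum (fun m _ => hC0 m) hm
        · linarith [norm_nonneg μ]
        · exact Finset.le_sup (f := Prod.fst) hm
    _ = _ := by ring

lemma SchwartzMap.integrable_one_add_norm_pow_mul {N : ℕ} (φ : 𝓢(EuclideanSpace ℝ (Fin N), ℂ))
    (k : ℕ) : Integrable fun μ => (1 + ‖μ‖) ^ k * ‖φ μ‖ := by
  refine (((φ.integrable (μ := volume)).norm.add (φ.integrable_pow_mul volume k)).const_mul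
    (2 ^ (k - 1))).mono' (Continuous.aestronglyMeasurable (by fun_prop))
    (Filter.Eventually.of_forall fun μ => ?_)
  rw [Real.norm_of_nonneg (by positivity)]
  have := add_pow_le zero_le_one (norm_nonneg μ) k
  rw [one_pow] at this
  calc (1 + ‖μ‖) ^ k * ‖φ μ‖ ≤ (2 ^ (k - 1) * (1 + ‖μ‖ ^ k)) * ‖φ μ‖ := by gcongr
    _ = _ := by simp only [Pi.add_apply]; ring

/-- Pairing a tempered distribution `T` which is a function `f` with a translate of `b ≥ 0`: the
integral converges absolutely if `f` is bounded below. -/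
lemma IsFunction.apply_translation {N : ℕ} {T : 𝓢'(EuclideanSpace ℝ (Fin N), ℂ)}
    {f q : EuclideanSpace ℝ (Fin N) → ℝ} (hf : IsFunction T f) (hq : ∀ᵐ θ, -q θ ≤ f θ)
    (b : 𝓢(EuclideanSpace ℝ (Fin N), ℝ)) (hb : ∀ θ, 0 ≤ b θ) (μ : EuclideanSpace ℝ (Fin N))
    (hqb : Integrable fun θ => q θ * b (θ - μ)) :
    Integrable (fun θ => f θ * b (θ - μ)) ∧
      T (SchwartzMap.compSubConstCLM ℝ μ b).complexify = ((∫ θ, f θ * b (θ - μ) : ℝ) : ℂ) := by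
  have h : ∀ θ, SchwartzMap.compSubConstCLM ℝ μ b θ = b (θ - μ) := fun θ =>
    SchwartzMap.compSubConstCLM_apply b μ θ
  have h1 : Integrable (fun θ => f θ * b (θ - μ)) := by
    have := hf.integrable_mul_of_neg_le hq (SchwartzMap.compSubConstCLM ℝ μ b)
      (fun θ => by rw [h]; exact hb _) (by simpa only [h] using hqb)
    simpa only [h] using this
  refine ⟨h1, ?_⟩
  rw [hf.apply_eq_integral _ (by simpa [h] using h1.ofReal (𝕜 := ℂ)), ← integral_complex_ofReal]
  simp [h]

/-- Fubini's theorem for a tempered distribution `T` which is a function `f` bounded below: pairing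
`T` with a convolution `b * φ` averages its pairings with the translates of `b` against `φ`. The
double integral converges absolutely because those pairings grow at most polynomially. -/
lemma IsFunction.apply_convolution {N : ℕ} {T : 𝓢'(EuclideanSpace ℝ (Fin N), ℂ)}
    {f q : EuclideanSpace ℝ (Fin N) → ℝ} (hf : IsFunction T f) (hq : ∀ᵐ θ, -q θ ≤ f θ)
    (hq0 : ∀ θ, 0 ≤ q θ) (b : 𝓢(EuclideanSpace ℝ (Fin N), ℝ)) (hb : ∀ θ, 0 ≤ b θ)
    (hqb : ∀ μ, Integrable fun θ => q θ * b (θ - μ)) {M : ℝ}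
    (hM : ∀ μ, ∫ θ, q θ * b (θ - μ) ≤ M) (φ : 𝓢(EuclideanSpace ℝ (Fin N), ℂ)) :
    T (SchwartzMap.convolution (ContinuousLinearMap.mul ℂ ℂ) b.complexify φ)
      = ∫ μ, ((∫ θ, f θ * b (θ - μ) : ℝ) : ℂ) * φ μ := by
  have hμ := fun μ => hf.apply_translation hq b hb μ (hqb μ)
  set F : EuclideanSpace ℝ (Fin N) × EuclideanSpace ℝ (Fin N) → ℂ :=
    fun p => ((f p.1 * b (p.1 - p.2) : ℝ) : ℂ) * φ p.2 with hF
  have hFm : AEStronglyMeasurable F (volume.prod volume) := by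
    have h1 : AEStronglyMeasurable (fun p : EuclideanSpace ℝ (Fin N) × EuclideanSpace ℝ (Fin N) =>
        f p.1) (volume.prod volume) := hf.1.aestronglyMeasurable.comp_fst
    have h2 : Continuous (fun p : EuclideanSpace ℝ (Fin N) × EuclideanSpace ℝ (Fin N) =>
        b (p.1 - p.2)) := by fun_prop
    have h3 : Continuous (fun p : EuclideanSpace ℝ (Fin N) × EuclideanSpace ℝ (Fin N) =>
        φ p.2) := by fun_prop
    exact (Complex.continuous_ofReal.comp_aestronglyMeasurable
      (h1.mul h2.aestronglyMeasurable)).mul h3.aestronglyMeasurable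
  obtain ⟨C, k, hC⟩ := T.exists_norm_apply_compSubConstCLM_le b.complexify
  have hFμ : ∀ μ, Integrable fun θ => F (θ, μ) := fun μ =>
    (hμ μ).1.ofReal (𝕜 := ℂ) |>.mul_const (φ μ)
  have hFi : Integrable F (volume.prod volume) := by
    rw [integrable_prod_iff' hFm]
    refine ⟨Filter.Eventually.of_forall hFμ, ?_⟩
    refine Integrable.mono' (((φ.integrable_one_add_norm_pow_mul k).const_mul C).add
      ((φ.integrable (μ := volume)).norm.const_mul (2 * M)))
      hFm.norm.prod_swap.integral_prod_right' (Filter.Eventually.of_forall fun μ => ?_)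
    rw [Real.norm_of_nonneg (integral_nonneg fun θ => norm_nonneg _)]
    have h1 : ∫ θ, ‖F (θ, μ)‖ ≤ ∫ θ, (f θ * b (θ - μ) + 2 * (q θ * b (θ - μ))) * ‖φ μ‖ := by
      refine integral_mono_ae (hFμ μ).norm
        (((hμ μ).1.add ((hqb μ).const_mul 2)).mul_const _) ?_
      filter_upwards [hq] with θ hθ
      simp only [hF, norm_mul, Complex.norm_real]
      refine mul_le_mul_of_nonneg_right ?_ (norm_nonneg _)
      rw [Real.norm_of_nonneg (hb (θ - μ)), Real.norm_eq_abs]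
      have h2 : |f θ| ≤ f θ + 2 * q θ := abs_le.2 ⟨by linarith, by linarith [hq0 θ]⟩
      nlinarith [hb (θ - μ)]
    refine h1.trans ?_
    rw [integral_mul_const, integral_add (hμ μ).1 ((hqb μ).const_mul 2), integral_const_mul]
    have h3 : ∫ θ, f θ * b (θ - μ) ≤ C * (1 + ‖μ‖) ^ k := by
      have h4 := hC μ
      have h5 : SchwartzMap.compSubConstCLM ℂ μ b.complexify
          = (SchwartzMap.compSubConstCLM ℝ μ b).complexify := by
        ext θ
        simp [SchwartzMap.compSubConstCLM_apply]
      rw [h5, (hμ μ).2, Complex.norm_real] at h4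
      exact (Real.le_norm_self _).trans h4
    calc _ ≤ (C * (1 + ‖μ‖) ^ k + 2 * M) * ‖φ μ‖ := by
          gcongr
          exact hM μ
      _ = _ := by simp only [Pi.add_apply]; ring
  have hconv : ∀ θ, (f θ : ℂ) *
      SchwartzMap.convolution (ContinuousLinearMap.mul ℂ ℂ) b.complexify φ θ
      = ∫ μ, F (θ, μ) := by
    intro θ
    rw [SchwartzMap.convolution_apply, convolution_mul_swap, ← integral_const_mul]
    refine integral_congr_ae (Filter.Eventually.of_forall fun μ => ?_)
    simp [hF, mul_assoc]
  rw [hf.apply_eq_integral _ (by simpa only [hconv] using hFi.integral_prod_left)]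
  simp_rw [hconv]
  rw [integral_integral_swap hFi]
  refine integral_congr_ae (Filter.Eventually.of_forall fun μ => ?_)
  simp only [hF]
  rw [integral_mul_const, integral_complex_ofReal]

/-- If the Fourier transform of `b` vanishes nowhere, a tempered distribution is determined by its
values on the convolutions `b * φ`: these contain the inverse Fourier transforms of all smooth
compactly supported functions, which are dense. -/
lemma TemperedDistribution.eq_zero_of_apply_convolution_eq_zero {E : Type*} [NormedAddCommGroup E]
    [InnerProductSpace ℝ E] [FiniteDimensional ℝ E] [MeasurableSpace E] [BorelSpace E]
    (W : 𝓢'(E, ℂ)) (b : 𝓢(E, ℂ)) (hb : ∀ ξ, 𝓕 b ξ ≠ 0)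
    (hW : ∀ φ, W (SchwartzMap.convolution (ContinuousLinearMap.mul ℂ ℂ) b φ) = 0)
    (ψ : 𝓢(E, ℂ)) : W ψ = 0 := by
  have hcs : ∀ u : 𝓢(E, ℂ), HasCompactSupport u → W (𝓕⁻ u) = 0 := by
    intro u hu
    have hqc : HasCompactSupport (fun ξ => u ξ / 𝓕 b ξ) := by
      simp_rw [div_eq_mul_inv]
      exact hu.mul_right
    have hqs : ContDiff ℝ ∞ (fun ξ => u ξ / 𝓕 b ξ) := by
      simp_rw [div_eq_mul_inv]
      exact (u.smooth ⊤).mul (((𝓕 b).smooth ⊤).inv hb)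
    have h1 : SchwartzMap.convolution (ContinuousLinearMap.mul ℂ ℂ) b
        (𝓕⁻ (hqc.toSchwartzMap hqs)) = 𝓕⁻ u := by
      rw [← FourierTransform.fourierInv_fourier_eq (E := 𝓢(E, ℂ)) (F := 𝓢(E, ℂ))
        (SchwartzMap.convolution _ _ _), SchwartzMap.fourier_convolution, FourierTransform.fourier_fourierInv_eq]
      congr 1
      ext ξ
      simp [mul_div_cancel₀ _ (hb ξ)]
    rw [← h1, hW]
  obtain ⟨η, hηc, hηs, -, -, -, hη⟩ := SchwartzMap.exists_cutoff_tendsto E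
  have h0 : ∀ n, W (𝓕⁻ (SchwartzMap.smulLeftCLM ℂ (fun x => (η n x : ℂ)) (𝓕 ψ))) = 0 := by
    intro n
    have hc : HasCompactSupport (fun x => (η n x : ℂ)) :=
      (hηc n).comp_left (g := fun t : ℝ => (t : ℂ)) Complex.ofReal_zero
    refine hcs _ ?_
    rw [SchwartzMap.smulLeftCLM_apply
      (hc.hasTemperateGrowth (Complex.ofRealCLM.contDiff.comp (hηs n)))]
    exact hc.smul_right
  have hcont : Continuous fun u : 𝓢(E, ℂ) => W (𝓕⁻ u) :=
    W.continuous.comp (FourierTransform.fourierInvCLM ℂ 𝓢(E, ℂ)).continuous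
  have hlim := (hcont.tendsto (𝓕 ψ)).comp (hη (𝓕 ψ))
  rw [FourierTransform.fourierInv_fourier_eq] at hlim
  exact tendsto_nhds_unique (hlim.congr h0) tendsto_const_nhds

lemma IsFunction.integrable_ofReal_mul {N : ℕ} {T : 𝓢'(EuclideanSpace ℝ (Fin N), ℂ)}
    {f : EuclideanSpace ℝ (Fin N) → ℝ} (hf : IsFunction T f)
    (φ : 𝓢(EuclideanSpace ℝ (Fin N), ℂ)) (hφ : HasCompactSupport φ) :
    Integrable fun θ => (f θ : ℂ) * φ θ := by
  simpa only [Complex.real_smul] using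
    hf.1.integrable_smul_right_of_hasCompactSupport φ.continuous hφ

lemma IsFunction.add {N : ℕ} {T₁ T₂ : 𝓢'(EuclideanSpace ℝ (Fin N), ℂ)}
    {f₁ f₂ : EuclideanSpace ℝ (Fin N) → ℝ} (h₁ : IsFunction T₁ f₁) (h₂ : IsFunction T₂ f₂) :
    IsFunction (T₁ + T₂) (fun θ => f₁ θ + f₂ θ) := by
  refine ⟨h₁.1.add h₂.1, fun φ hφ => ?_⟩
  simp only [Complex.ofReal_add, add_mul]
  rw [integral_add (h₁.integrable_ofReal_mul φ hφ) (h₂.integrable_ofReal_mul φ hφ),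
    ← h₁.2 φ hφ, ← h₂.2 φ hφ]
  rfl

lemma IsFunction.neg {N : ℕ} {T : 𝓢'(EuclideanSpace ℝ (Fin N), ℂ)}
    {f : EuclideanSpace ℝ (Fin N) → ℝ} (h : IsFunction T f) :
    IsFunction (-T) (fun θ => -f θ) := by
  refine ⟨h.1.neg, fun φ hφ => ?_⟩
  simp only [Complex.ofReal_neg, neg_mul]
  rw [integral_neg, ← h.2 φ hφ]
  rfl

lemma isFunction_const {N : ℕ} (c : ℝ) :
    IsFunction ((c : ℂ) • (volume : Measure (EuclideanSpace ℝ (Fin N))).toTemperedDistribution)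
      (fun _ => c) := by
  refine ⟨locallyIntegrable_const c, fun φ _ => ?_⟩
  rw [integral_const_mul]
  rfl

/-- A function is determined almost everywhere by its tempered distribution. -/
lemma IsFunction.ae_eq {N : ℕ} {T : 𝓢'(EuclideanSpace ℝ (Fin N), ℂ)}
    {f₁ f₂ : EuclideanSpace ℝ (Fin N) → ℝ} (h₁ : IsFunction T f₁) (h₂ : IsFunction T f₂) :
    f₁ =ᵐ[volume] f₂ := by
  refine ae_eq_of_integral_contDiff_smul_eq h₁.1 h₂.1 fun u hu huc => ?_
  have hc : HasCompactSupport (fun x => (u x : ℂ)) :=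
    huc.comp_left (g := fun t : ℝ => (t : ℂ)) Complex.ofReal_zero
  have hs : ContDiff ℝ ∞ (fun x => (u x : ℂ)) := Complex.ofRealCLM.contDiff.comp hu
  have h := (h₁.2 (hc.toSchwartzMap hs) hc).symm.trans (h₂.2 (hc.toSchwartzMap hs) hc)
  simp only [HasCompactSupport.toSchwartzMap_toFun, ← Complex.ofReal_mul,
    integral_complex_ofReal, Complex.ofReal_inj] at h
  simpa only [smul_eq_mul, mul_comm] using h

/-- Uniqueness in the deconvolution problem: a semibounded function which is a tempered distribution
is determined almost everywhere by its integrals against the translates of a density whose Fourier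
transform vanishes nowhere. -/
lemma IsFunction.ae_eq_of_integral_translation_eq {N : ℕ}
    {T₁ T₂ : 𝓢'(EuclideanSpace ℝ (Fin N), ℂ)} {f₁ f₂ q₁ q₂ : EuclideanSpace ℝ (Fin N) → ℝ}
    (h₁ : IsFunction T₁ f₁) (h₂ : IsFunction T₂ f₂)
    (hq₁ : ∀ᵐ θ, -q₁ θ ≤ f₁ θ) (hq₂ : ∀ᵐ θ, -q₂ θ ≤ f₂ θ) (hp₁ : ∀ θ, 0 ≤ q₁ θ)
    (hp₂ : ∀ θ, 0 ≤ q₂ θ) (b : 𝓢(EuclideanSpace ℝ (Fin N), ℝ)) (hb : ∀ θ, 0 ≤ b θ)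
    (hbF : ∀ ξ, 𝓕 b.complexify ξ ≠ 0)
    (hi₁ : ∀ μ, Integrable fun θ => q₁ θ * b (θ - μ))
    (hi₂ : ∀ μ, Integrable fun θ => q₂ θ * b (θ - μ)) {M₁ M₂ : ℝ}
    (hM₁ : ∀ μ, ∫ θ, q₁ θ * b (θ - μ) ≤ M₁) (hM₂ : ∀ μ, ∫ θ, q₂ θ * b (θ - μ) ≤ M₂)
    (h : ∀ μ, ∫ θ, f₁ θ * b (θ - μ) = ∫ θ, f₂ θ * b (θ - μ)) : f₁ =ᵐ[volume] f₂ := by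
  have hT : T₁ = T₂ := by
    ext ψ
    refine sub_eq_zero.1 ((T₁ - T₂).eq_zero_of_apply_convolution_eq_zero b.complexify hbF
      (fun φ => ?_) ψ)
    have h3 := h₁.apply_convolution hq₁ hp₁ b hb hi₁ hM₁ φ
    simp_rw [h] at h3
    exact sub_eq_zero.2 (h3.trans (h₂.apply_convolution hq₂ hp₂ b hb hi₂ hM₂ φ).symm)
  rw [← hT] at h₂
  exact h₁.ae_eq h₂

/-! ### Relative entropy -/

lemma log_div_mul_ae_eq {N : ℕ} (f : EuclideanSpace ℝ (Fin N) → ℝ)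
    {α : EuclideanSpace ℝ (Fin N) → ℝ} (hα : ∀ᵐ θ, 0 < α θ) :
    (fun θ => Real.log (f θ / α θ) * f θ) =ᵐ[volume]
      fun θ => f θ * Real.log (f θ) + -Real.log (α θ) * f θ := by
  filter_upwards [hα] with θ hθ
  rcases eq_or_ne (f θ) 0 with h0 | h0
  · simp [h0]
  · rw [Real.log_div h0 hθ.ne']
    ring

lemma klDensity_eq_coe {N : ℕ} {f α : EuclideanSpace ℝ (Fin N) → ℝ} (hα : ∀ᵐ θ, 0 < α θ)
    (hf : HasFiniteEntropy f) (hfα : Integrable fun θ => -Real.log (α θ) * f θ) :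
    klDensity f α = ((-entropy f + ∫ θ, -Real.log (α θ) * f θ : ℝ) : EReal) := by
  have h := log_div_mul_ae_eq f hα
  have hf' : Integrable fun θ => f θ * Real.log (f θ) := hf
  rw [klDensity, if_pos ⟨hα.mono fun θ hθ h0 => absurd h0 hθ.ne', (hf'.add hfα).congr h.symm⟩,
    integral_congr_ae h, integral_add hf' hfα, entropy, neg_neg]

lemma integrable_neg_log_mul_of_klDensity_ne_top {N : ℕ} {f α : EuclideanSpace ℝ (Fin N) → ℝ}
    (hα : ∀ᵐ θ, 0 < α θ) (hf : HasFiniteEntropy f) (h : klDensity f α ≠ ⊤) :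
    Integrable fun θ => -Real.log (α θ) * f θ := by
  have h1 : Integrable fun θ => Real.log (f θ / α θ) * f θ := by
    by_contra h2
    exact h (if_neg fun h3 => h2 h3.2)
  have hf' : Integrable fun θ => f θ * Real.log (f θ) := hf
  refine ((h1.congr (log_div_mul_ae_eq f hα)).sub hf').congr
    (Filter.Eventually.of_forall fun θ => ?_)
  simp

lemma integrable_exp_neg_mul_norm_rpow {E : Type*} [NormedAddCommGroup E] [NormedSpace ℝ E]
    [FiniteDimensional ℝ E] [MeasurableSpace E] [BorelSpace E] (ν : Measure E)
    [ν.IsAddHaarMeasure] {a b : ℝ} (ha : 0 < a) (hb : 0 < b) :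
    Integrable (fun θ => Real.exp (-(a * ‖θ‖ ^ b))) ν := by
  set s : ℝ := Module.finrank ℝ E + 1 with hs
  have hs0 : 0 < s := by positivity
  obtain ⟨n, hn⟩ := exists_nat_ge (s / b)
  have hn' : s ≤ b * n := by rwa [div_le_iff₀' hb] at hn
  set C : ℝ := 2 ^ s * (1 + (n.factorial : ℝ) / a ^ n) with hC
  have hC1 : (2 : ℝ) ^ s ≤ C := le_mul_of_one_le_right (by positivity)
    (le_add_of_nonneg_right (by positivity))
  have hkey : ∀ t : ℝ, 0 ≤ t → (1 + t) ^ s ≤ C * Real.exp (a * t ^ b) := by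
    intro t ht
    have htb : 0 ≤ a * t ^ b := mul_nonneg ha.le (Real.rpow_nonneg ht b)
    rcases le_total t 1 with h1 | h1
    · calc (1 + t) ^ s ≤ 2 ^ s := Real.rpow_le_rpow (by linarith) (by linarith) hs0.le
        _ ≤ C := hC1
        _ ≤ C * Real.exp (a * t ^ b) :=
          le_mul_of_one_le_right (by positivity) (Real.one_le_exp htb)
    · have h2 := Real.pow_div_factorial_le_exp (a * t ^ b) htb n
      have h3 : t ^ s ≤ (t ^ b) ^ n := by
        rw [← Real.rpow_natCast, ← Real.rpow_mul ht]
        exact Real.rpow_le_rpow_of_exponent_le h1 hn'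
      calc (1 + t) ^ s ≤ (2 * t) ^ s :=
            Real.rpow_le_rpow (by linarith) (by linarith) hs0.le
        _ = 2 ^ s * t ^ s := Real.mul_rpow zero_le_two ht
        _ ≤ 2 ^ s * (t ^ b) ^ n := by gcongr
        _ = 2 ^ s * ((n.factorial : ℝ) / a ^ n) * ((a * t ^ b) ^ n / n.factorial) := by
            have := n.factorial_ne_zero
            rw [mul_pow]
            field_simp
        _ ≤ 2 ^ s * ((n.factorial : ℝ) / a ^ n) * Real.exp (a * t ^ b) := by gcongr
        _ ≤ C * Real.exp (a * t ^ b) := by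
            gcongr
            rw [hC]
            gcongr
            linarith
  have hint : Integrable (fun θ : E => C * (1 + ‖θ‖) ^ (-s)) ν :=
    (integrable_one_add_norm (by rw [hs]; linarith)).const_mul C
  refine hint.mono' (Continuous.aestronglyMeasurable ?_) (Filter.Eventually.of_forall fun θ => ?_)
  · exact Real.continuous_exp.comp
      ((continuous_norm.rpow_const fun _ => Or.inr hb.le).const_mul a).neg
  · rw [Real.norm_of_nonneg (Real.exp_pos _).le, Real.exp_neg, Real.rpow_neg (by positivity),
      ← div_eq_mul_inv, inv_eq_one_div, div_le_div_iff₀ (Real.exp_pos _) (by positivity), one_mul]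
    exact hkey _ (norm_nonneg θ)

/-! ### The prior of a penalty -/

lemma entropy_comp_sub_right {N : ℕ} (f : EuclideanSpace ℝ (Fin N) → ℝ)
    (μ : EuclideanSpace ℝ (Fin N)) : entropy (fun θ => f (θ - μ)) = entropy f := by
  rw [entropy, entropy, integral_sub_right_eq_self (fun θ => f θ * Real.log (f θ)) μ]

theorem corollary1 (N : ℕ)
    (β : EuclideanSpace ℝ (Fin N) → EuclideanSpace ℝ (Fin N) → ℝ)
    (hβ_density : ∀ μ, IsProbDensity (β μ))
    (hβ_transl : ∀ μ θ, β μ θ = β 0 (θ - μ))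
    (hβ_schwartz : ∃ f : 𝓢(EuclideanSpace ℝ (Fin N), ℝ), ∀ θ, f θ = β 0 θ)
    (hβ_entropy : HasFiniteEntropy (β 0))
    (hβ_fourier : ∀ ξ, 𝓕 (fun θ : EuclideanSpace ℝ (Fin N) => (β 0 θ : ℂ)) ξ ≠ 0)
    (r : EuclideanSpace ℝ (Fin N) → ℝ) (hr_cont : Continuous r)
    (R : 𝓢'(EuclideanSpace ℝ (Fin N), ℂ)) (hR : IsFunction R r)
    (hR_fourier : IsCompact (dsupport (𝓕 R : 𝓢'(EuclideanSpace ℝ (Fin N), ℂ))))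
    (g : EuclideanSpace ℝ (Fin N) → ℝ) (hg : IsFunction (deconvolution R (β 0)) g)
    (hg_bound : ∃ a b k : ℝ, 0 < a ∧ 0 < b ∧ ∀ θ, a * ‖θ‖ ^ b + k ≤ g θ) :
    ∃ κ : ℝ, 0 < κ ∧ ∃ α : EuclideanSpace ℝ (Fin N) → ℝ,
      (∀ θ, α θ = 1 / κ * Real.exp (- entropy (β 0) - g θ)) ∧
      IsProbDensity α ∧
      IsPenaltyOfPrior r β α ∧
      IsLogTempered α ∧
      ∀ α' : EuclideanSpace ℝ (Fin N) → ℝ,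
        IsProbDensity α' → IsPenaltyOfPrior r β α' → IsLogTempered α' → α' =ᵐ[volume] α := by
  obtain ⟨b, hb⟩ := hβ_schwartz
  have hb' : ⇑b = β 0 := funext hb
  have hβb : ∀ μ, β μ = fun θ => b (θ - μ) := fun μ => funext fun θ => by rw [hβ_transl, hb]
  have hb0 : ∀ θ, 0 ≤ b θ := fun θ => by rw [hb]; exact (hβ_density 0).1 θ
  have hbi : ∀ μ, Integrable fun θ => b (θ - μ) := fun μ => (b.integrable).comp_sub_right μ
  have hb1 : ∀ μ, ∫ θ, b (θ - μ) = 1 := fun μ => by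
    rw [← hβb]
    exact (hβ_density μ).2.2
  have hbF : ∀ ξ, 𝓕 b.complexify ξ ≠ 0 := fun ξ => by
    have h : ⇑b.complexify = fun θ => (β 0 θ : ℂ) := funext fun θ => by
      rw [SchwartzMap.complexify_apply, hb]
    rw [SchwartzMap.fourier_coe, h]
    exact hβ_fourier ξ
  have hent : ∀ μ, HasFiniteEntropy (β μ) ∧ entropy (β μ) = entropy (β 0) := fun μ => by
    have h : β μ = fun θ => β 0 (θ - μ) := funext (hβ_transl μ)
    rw [h]
    exact ⟨hβ_entropy.comp_sub_right μ, entropy_comp_sub_right _ μ⟩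
  -- The function `g` solves `β̌ * g = r`.
  obtain ⟨a, c, k, ha, hc, hgk⟩ := hg_bound
  have hgq : ∀ᵐ θ, -(fun _ => |k| : EuclideanSpace ℝ (Fin N) → ℝ) θ ≤ g θ :=
    Filter.Eventually.of_forall fun θ => by
      have h1 : 0 ≤ a * ‖θ‖ ^ c := by positivity
      linarith [hgk θ, neg_abs_le k]
  have hgμ : ∀ μ, Integrable (fun θ => g θ * b (θ - μ)) ∧ ∫ θ, g θ * b (θ - μ) = r μ := by
    intro μ
    obtain ⟨h1, h2⟩ := hg.apply_translation hgq b hb0 μ ((hbi μ).const_mul |k|)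
    rw [← hb', deconvolution_apply_translation hR hr_cont hR_fourier b hbF μ] at h2
    exact ⟨h1, (Complex.ofReal_injective h2).symm⟩
  have hexp : Integrable fun θ => Real.exp (-entropy (β 0) - g θ) := by
    refine ((integrable_exp_neg_mul_norm_rpow volume ha hc).const_mul
      (Real.exp (-entropy (β 0) - k))).mono'
      (Real.continuous_exp.comp_aestronglyMeasurable
        (aestronglyMeasurable_const.sub hg.1.aestronglyMeasurable))
      (Filter.Eventually.of_forall fun θ => ?_)
    rw [Real.norm_of_nonneg (Real.exp_pos _).le, ← Real.exp_add, Real.exp_le_exp]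
    linarith [hgk θ]
  set κ : ℝ := ∫ θ, Real.exp (-entropy (β 0) - g θ) with hκ
  have hκ0 : 0 < κ := integral_exp_pos hexp
  set α : EuclideanSpace ℝ (Fin N) → ℝ :=
    fun θ => 1 / κ * Real.exp (-entropy (β 0) - g θ) with hα
  have hα0 : ∀ θ, 0 < α θ := fun θ => by positivity
  have hαlog : ∀ θ, Real.log (α θ) = -g θ + (-Real.log κ - entropy (β 0)) := fun θ => by
    rw [hα, Real.log_mul (by positivity) (Real.exp_pos _).ne', Real.log_exp, one_div, Real.log_inv]
    ring
  have hαd : IsProbDensity α := by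
    refine ⟨fun θ => (hα0 θ).le, hexp.const_mul _, ?_⟩
    rw [hα, integral_const_mul, one_div, ← hκ, inv_mul_cancel₀ hκ0.ne']
  have hαT : IsLogTempered α := by
    have h := hg.neg.add (isFunction_const (-Real.log κ - entropy (β 0)))
    simp_rw [← hαlog] at h
    exact ⟨Filter.Eventually.of_forall hα0, _, h⟩
  refine ⟨κ, hκ0, α, fun θ => rfl, hαd, ⟨-Real.log κ, fun μ => ?_⟩, hαT, fun α' hα'd hα'r hα't => ?_⟩
  · have h1 : ∀ θ, -Real.log (α θ) * β μ θ
        = g θ * b (θ - μ) + (Real.log κ + entropy (β 0)) * b (θ - μ) := fun θ => by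
      rw [hαlog, hβb μ]
      ring
    have h2 : Integrable fun θ => -Real.log (α θ) * β μ θ := by
      simp_rw [h1]
      exact (hgμ μ).1.add ((hbi μ).const_mul _)
    rw [klDensity_eq_coe (Filter.Eventually.of_forall hα0) (hent μ).1 h2, (hent μ).2]
    simp_rw [h1]
    rw [integral_add (hgμ μ).1 ((hbi μ).const_mul _), integral_const_mul, hb1, (hgμ μ).2,
      ← EReal.coe_add]
    congr 1
    ring
  · obtain ⟨K, hK⟩ := hα'r
    obtain ⟨hα'0, T, hT⟩ := hα't
    have hint : ∀ μ, Integrable fun θ => -Real.log (α' θ) * β μ θ := fun μ =>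
      integrable_neg_log_mul_of_klDensity_ne_top hα'0 (hent μ).1 fun h => by
        have := hK μ
        rw [h, EReal.top_add_coe] at this
        exact EReal.coe_ne_top _ this
    set C : ℝ := entropy (β 0) - K with hC
    have hval : ∀ μ, ∫ θ, -Real.log (α' θ) * b (θ - μ) = r μ + C := fun μ => by
      have h1 := hK μ
      rw [klDensity_eq_coe hα'0 (hent μ).1 (hint μ), (hent μ).2, ← EReal.coe_add,
        EReal.coe_eq_coe_iff, hβb μ] at h1
      rw [h1]
      ring
    -- As `log α' ≤ α'`, the function `-log α'` is bounded below by the integrable `-α'`.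
    have hq1 : ∀ᵐ θ, -α' θ ≤ -Real.log (α' θ) := hα'0.mono fun θ hθ => by
      linarith [Real.log_le_sub_one_of_pos hθ]
    have hq2 : ∀ᵐ θ, -(fun _ => |k| + |C| : EuclideanSpace ℝ (Fin N) → ℝ) θ ≤ g θ + C :=
      hgq.mono fun θ hθ => by linarith [neg_abs_le C]
    have hα'b : ∀ μ, Integrable fun θ => α' θ * b (θ - μ) := fun μ =>
      hα'd.2.1.mul_bdd (c := SchwartzMap.seminorm ℝ 0 0 b)
        (by fun_prop : Continuous fun θ => b (θ - μ)).aestronglyMeasurable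
        (Filter.Eventually.of_forall fun θ => b.norm_le_seminorm ℝ _)
    have hM : ∀ μ, ∫ θ, α' θ * b (θ - μ) ≤ SchwartzMap.seminorm ℝ 0 0 b := fun μ => by
      calc ∫ θ, α' θ * b (θ - μ) ≤ ∫ θ, α' θ * SchwartzMap.seminorm ℝ 0 0 b :=
            integral_mono (hα'b μ) (hα'd.2.1.mul_const _) fun θ =>
              mul_le_mul_of_nonneg_left ((Real.le_norm_self _).trans (b.norm_le_seminorm ℝ _))
                (hα'd.1 θ)
        _ = _ := by rw [integral_mul_const, hα'd.2.2, one_mul]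
    have hae : (fun θ => -Real.log (α' θ)) =ᵐ[volume] fun θ => g θ + C := by
      refine hT.neg.ae_eq_of_integral_translation_eq (hg.add (isFunction_const C)) hq1 hq2 hα'd.1
        (fun _ => by positivity) b hb0 hbF hα'b (fun μ => (hbi μ).const_mul _) hM
        (M₂ := |k| + |C|) (fun μ => ?_) fun μ => ?_
      · rw [integral_const_mul, hb1, mul_one]
      · simp_rw [hval, add_mul]
        rw [integral_add (hgμ μ).1 ((hbi μ).const_mul _), integral_const_mul, hb1, (hgμ μ).2,
          mul_one]
    -- Hence `α'` is a multiple of `α`, and both have integral `1`.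
    set D : ℝ := κ * Real.exp (entropy (β 0) - C) with hD
    have hprop : α' =ᵐ[volume] fun θ => D * α θ := by
      filter_upwards [hae, hα'0] with θ h1 h2
      have h3 : D * α θ = Real.exp (entropy (β 0) - C) * Real.exp (-entropy (β 0) - g θ) := by
        rw [hD, hα]
        field_simp
      rw [h3, ← Real.exp_add, ← Real.exp_log h2]
      congr 1
      linarith
    have hD1 : D = 1 := by
      have h1 := integral_congr_ae hprop
      rwa [integral_const_mul, hα'd.2.2, hαd.2.2, mul_one, eq_comm] at h1
    simpa only [hD1, one_mul] using hprop
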